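/- Let $T^2=\mathbb{R}^2/\mathbb{Z}^2$, and let $c:T^2\to T^2$ be a real structure, that is, a smooth orientation-reversing map with $c\circ c=\mathrm{id}$. Let $u,v\subset T^2$ be smooth simple closed curves (embedded circles) that are invariant under $c$, meaning $c(u)=u$ and $c(v)=v$ as sets. Define the (geometric) intersection number of $u$ and $v$ to be $$ i(u,v)=\min\{\,|u'\cap v'| \;:\; u',v' \text{ smooth simple closed curves in } T^2 \text{ freely homotopic to } u,v \text{ respectively}\,\}.$$ Then $i(u,v)\in\{0,1,2\}$. -/

import Mathlib

namespace RealTorus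

/-- The torus `T² = ℝ²/ℤ²`. -/
abbrev Torus : Type := UnitAddCircle × UnitAddCircle

/-- The universal covering map `ℝ² → ℝ²/ℤ²`. -/
def proj (p : ℝ × ℝ) : Torus := ((p.1 : UnitAddCircle), (p.2 : UnitAddCircle))

/-- A real structure on the torus: a smooth orientation-reversing involution.
Smoothness and the behaviour on the orientation are read off from a lift `C : ℝ² → ℝ²`
to the universal covering (lifts of a continuous self-map always exist, and any two of them
differ by a constant in `ℤ²`). -/
structure IsRealStructure (c : Torus → Torus) : Prop where
  involutive : Function.Involutive c
  smooth_orientation_reversing : ∃ C : ℝ × ℝ → ℝ × ℝ,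
    ContDiff ℝ ((⊤ : ℕ∞) : WithTop ℕ∞) C ∧
    (∀ p, proj (C p) = c (proj p)) ∧
    ∀ p, LinearMap.det (fderiv ℝ C p : ℝ × ℝ →ₗ[ℝ] ℝ × ℝ) < 0

/-- A (parametrized) smooth simple closed curve on the torus: an injective smooth immersion of
the circle `ℝ/ℤ`, where smoothness and the derivative are read off from a lift `g : ℝ → ℝ²`. -/
structure IsSimpleClosedCurve (u : C(UnitAddCircle, Torus)) : Prop where
  injective : Function.Injective u
  smooth_immersion : ∃ g : ℝ → ℝ × ℝ,
    ContDiff ℝ ((⊤ : ℕ∞) : WithTop ℕ∞) g ∧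
    (∀ t : ℝ, proj (g t) = u (t : UnitAddCircle)) ∧
    ∀ t, deriv g t ≠ 0

/-- The curve (that is, the image of the parametrization) is mapped to itself by `c`. -/
def IsInvariant (c : Torus → Torus) (u : C(UnitAddCircle, Torus)) : Prop :=
  c '' Set.range u = Set.range u

/-- The geometric intersection number of two curves: the least number of points (possibly `⊤`)
in which two simple closed curves freely homotopic to the given ones meet. -/
noncomputable def intersectionNumber (u v : C(UnitAddCircle, Torus)) : ℕ∞ :=
  ⨅ (u' : C(UnitAddCircle, Torus)) (v' : C(UnitAddCircle, Torus))
    (_ : IsSimpleClosedCurve u' ∧ ContinuousMap.Homotopic u' u)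
    (_ : IsSimpleClosedCurve v' ∧ ContinuousMap.Homotopic v' v),
    (Set.range u' ∩ Set.range v').encard

end RealTorus

namespace RealTorus

/-! Lifting to the plane gives every closed curve a class in `ℤ²`, and curves of equal class are
freely homotopic. Hence `i(u,v)` is bounded above by any count for simple models, straight lines and
small circles, in the same classes; only the bound `≤ 2` is needed, so no lower bound on
intersections enters. The class of a simple closed curve is zero or primitive (`IsLift.isCoprime`).
If one class is zero, or the classes `a`, `b` are parallel, the models can be made disjoint.
Otherwise straight lines meet in at most `|det(a,b)|` points. A real structure acts on `ℤ²` by some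
`M` with `M² = 1`. Integrating the Jacobian of a lift over the unit square gives `det M < 0`, so `M`
has trace zero. Invariance makes `a` and `b` eigenvectors with eigenvalues `±1`, opposite unless the
classes are parallel. Say `M a = a` and `M b = -b`. Then `M + 1` maps into `ℤa`, so it is `a ⊗ λ`
with `λ` integral, `λ(a) = 2` and `λ(b) = 0`. As `b` is primitive, `λ` is an integer multiple of
`det(·,b)`, and evaluating at `a` shows that `det(a,b)` divides 2. -/

/-- The inclusion of the lattice `ℤ²` in the plane. -/
def intVec (m : ℤ × ℤ) : ℝ × ℝ := ((m.1 : ℝ), (m.2 : ℝ))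

lemma intVec_add (m n : ℤ × ℤ) : intVec (m + n) = intVec m + intVec n := by
  simp [intVec]

lemma intVec_injective : Function.Injective intVec := by
  intro m n h
  simpa [intVec, Prod.ext_iff] using h

lemma proj_add (p q : ℝ × ℝ) : proj (p + q) = proj p + proj q := by
  simp [proj]

lemma proj_sub (p q : ℝ × ℝ) : proj (p - q) = proj p - proj q := by
  simp [proj]

@[simp] lemma proj_zero : proj 0 = 0 := by
  simp [proj]

@[fun_prop] lemma continuous_proj : Continuous proj :=
  ((AddCircle.continuous_mk' 1).comp continuous_fst).prodMk
    ((AddCircle.continuous_mk' 1).comp continuous_snd)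

lemma coe_eq_zero_iff {x : ℝ} : (x : UnitAddCircle) = 0 ↔ ∃ n : ℤ, x = n := by
  rw [AddCircle.coe_eq_zero_iff]
  simp [eq_comm]

lemma coe_eq_coe_iff {x y : ℝ} : (x : UnitAddCircle) = y ↔ ∃ n : ℤ, x = y + n := by
  rw [← sub_eq_zero, ← AddCircle.coe_sub, coe_eq_zero_iff]
  simp [sub_eq_iff_eq_add']

lemma proj_eq_zero_iff {p : ℝ × ℝ} : proj p = 0 ↔ ∃ m, p = intVec m := by
  constructor
  · intro h
    obtain ⟨m, hm⟩ := coe_eq_zero_iff.1 (congrArg Prod.fst h)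
    obtain ⟨n, hn⟩ := coe_eq_zero_iff.1 (congrArg Prod.snd h)
    exact ⟨(m, n), Prod.ext hm hn⟩
  · rintro ⟨m, rfl⟩
    exact Prod.ext (coe_eq_zero_iff.2 ⟨_, rfl⟩) (coe_eq_zero_iff.2 ⟨_, rfl⟩)

lemma proj_intVec (m : ℤ × ℤ) : proj (intVec m) = 0 := proj_eq_zero_iff.2 ⟨m, rfl⟩

lemma proj_eq_iff {p q : ℝ × ℝ} : proj p = proj q ↔ ∃ m, p = q + intVec m := by
  rw [← sub_eq_zero, ← proj_sub, proj_eq_zero_iff]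
  simp [sub_eq_iff_eq_add']

/-! ### Lifts to the plane, classes in `ℤ²` and free homotopy -/

/-- Two continuous lifts of the same map to the torus differ by a constant lattice vector. -/
lemma exists_eq_add_intVec {X : Type*} [TopologicalSpace X] [PreconnectedSpace X] [Nonempty X]
    {f g : X → ℝ × ℝ} (hf : Continuous f) (hg : Continuous g)
    (h : ∀ x, proj (f x) = proj (g x)) : ∃ m, ∀ x, f x = g x + intVec m := by
  obtain ⟨x₀⟩ := ‹Nonempty X›
  obtain ⟨m, hm⟩ := proj_eq_iff.1 (h x₀)
  have h0 : ∀ x, proj (f x - g x) = 0 := fun x ↦ by rw [proj_sub, h, sub_self]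
  refine ⟨m, fun x ↦ ?_⟩
  have h1 := (AddCircle.isCoveringMap_coe (1 : ℝ)).const_of_comp
    (g := fun x ↦ (f x - g x).1) (by fun_prop)
    (fun a a' ↦ congrArg Prod.fst ((h0 a).trans (h0 a').symm)) x x₀
  have h2 := (AddCircle.isCoveringMap_coe (1 : ℝ)).const_of_comp
    (g := fun x ↦ (f x - g x).2) (by fun_prop)
    (fun a a' ↦ congrArg Prod.snd ((h0 a).trans (h0 a').symm)) x x₀
  have h3 : f x - g x = f x₀ - g x₀ := Prod.ext h1 h2
  rw [hm] at h3
  rw [← sub_eq_iff_eq_add', h3]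
  abel

/-- A continuous lift `g` to the plane of a closed curve `u` whose class in `ℤ²` is `a`. -/
structure IsLift (g : ℝ → ℝ × ℝ) (u : UnitAddCircle → Torus) (a : ℤ × ℤ) : Prop where
  continuous : Continuous g
  proj_eq : ∀ t : ℝ, proj (g t) = u t
  add_one : ∀ t, g (t + 1) = g t + intVec a

lemma exists_isLift {g : ℝ → ℝ × ℝ} {u : UnitAddCircle → Torus} (hg : Continuous g)
    (h : ∀ t : ℝ, proj (g t) = u t) : ∃ a, IsLift g u a := by
  obtain ⟨a, ha⟩ := exists_eq_add_intVec (f := fun t ↦ g (t + 1)) (g := g) (by fun_prop) hg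
    (fun t ↦ by rw [h, h]; simp)
  exact ⟨a, hg, h, ha⟩

lemma apply_add_intCast {E : Type*} [AddCommGroup E] {f : ℝ → E} {a : E}
    (h : ∀ t, f (t + 1) = f t + a) (t : ℝ) (n : ℤ) : f (t + n) = f t + n • a := by
  induction n using Int.induction_on with
  | zero => simp
  | succ n ih =>
    have := h (t + n)
    push_cast at ih ⊢
    rw [← add_assoc, this, ih, add_smul, one_smul, add_assoc]
  | pred n ih =>
    have := h (t - n - 1)
    rw [sub_add_cancel] at this
    push_cast at ih ⊢
    rw [← sub_eq_add_neg] at ih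
    rw [show t + (-(n : ℝ) - 1) = t - n - 1 by ring, sub_smul, one_smul,
      ← add_sub_assoc, ← ih, this, add_sub_cancel_right]

lemma continuous_periodic_lift {Y : Type*} [TopologicalSpace Y] {f : ℝ → Y}
    (hf : Continuous f) (hp : Function.Periodic f 1) :
    Continuous (hp.lift : UnitAddCircle → Y) :=
  continuous_coinduced_dom.2 hf

/-- Curves of the same class are freely homotopic. -/
lemma IsLift.homotopic {g g' : ℝ → ℝ × ℝ} {u u' : C(UnitAddCircle, Torus)} {a : ℤ × ℤ}
    (h : IsLift g u a) (h' : IsLift g' u' a) : ContinuousMap.Homotopic u' u := by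
  -- The common class cancels in the difference of lifts, which therefore descends to the circle;
  -- scaling it from 0 to 1 is the straight-line homotopy between the lifts.
  have hp : Function.Periodic (fun t ↦ g t - g' t) 1 := fun t ↦ by
    simp only [h.add_one, h'.add_one]; abel
  let K : UnitAddCircle → ℝ × ℝ := hp.lift
  have hK : Continuous K :=
    continuous_periodic_lift (h.continuous.sub h'.continuous) hp
  refine ⟨{ toFun := fun x ↦ u' x.2 + proj ((x.1 : ℝ) • K x.2)
            continuous_toFun := by fun_prop
            map_zero_left := fun x ↦ by simp
            map_one_left := fun x ↦ ?_ }⟩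
  induction x using QuotientAddGroup.induction_on with
  | H t =>
    have : K (t : UnitAddCircle) = g t - g' t := hp.lift_coe t
    simp [this, proj_sub, h.proj_eq, h'.proj_eq]

/-- A curve in the plane that closes up modulo `ℤ²` defines a closed curve on the torus. -/
lemma exists_curve {g : ℝ → ℝ × ℝ} {a : ℤ × ℤ} (hg : Continuous g)
    (ha : ∀ t, g (t + 1) = g t + intVec a) :
    ∃ u : C(UnitAddCircle, Torus), IsLift g u a := by
  have hp : Function.Periodic (fun t ↦ proj (g t)) 1 := fun t ↦ by
    simp only [ha, proj_add, proj_intVec, add_zero]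
  exact ⟨⟨hp.lift, continuous_periodic_lift (by fun_prop) hp⟩, hg,
    fun t ↦ (hp.lift_coe t).symm, ha⟩

lemma IsLift.injective {g : ℝ → ℝ × ℝ} {u : UnitAddCircle → Torus} {a : ℤ × ℤ}
    (h : IsLift g u a) (hinj : ∀ s t m, g s = g t + intVec m → ∃ n : ℤ, s = t + n) :
    Function.Injective u := by
  intro x y hxy
  induction x using QuotientAddGroup.induction_on with
  | H s =>
    induction y using QuotientAddGroup.induction_on with
    | H t =>
      rw [← h.proj_eq, ← h.proj_eq] at hxy
      obtain ⟨m, hm⟩ := proj_eq_iff.1 hxy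
      exact coe_eq_coe_iff.2 (hinj s t m hm)

/-! ### Model curves: lines and small circles -/

/-- A parametrized line of primitive direction gives a simple closed curve. -/
lemma exists_line (a : ℤ × ℤ) (ha : IsCoprime a.1 a.2) (w : ℝ × ℝ) :
    ∃ u : C(UnitAddCircle, Torus), IsLift (fun t ↦ t • intVec a + w) u a ∧
      IsSimpleClosedCurve u := by
  obtain ⟨u, hu⟩ := exists_curve (g := fun t ↦ t • intVec a + w) (a := a) (by fun_prop)
    (fun t ↦ by simp only [add_smul, one_smul]; abel)
  obtain ⟨x, y, hxy⟩ := ha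
  have hxy' : (x : ℝ) * a.1 + y * a.2 = 1 := mod_cast hxy
  refine ⟨u, hu, hu.injective ?_, _, ?_, hu.proj_eq, fun t ↦ ?_⟩
  · intro s t m h
    have h1 := congrArg Prod.fst h
    have h2 := congrArg Prod.snd h
    simp only [intVec, Prod.fst_add, Prod.snd_add, Prod.smul_fst, Prod.smul_snd,
      smul_eq_mul] at h1 h2
    -- The Bézout functional `(x, y)` takes the value 1 on `a`, so it reads off `s - t` as an
    -- integer.
    refine ⟨x * m.1 + y * m.2, ?_⟩
    push_cast
    linear_combination x * h1 + y * h2 - (s - t) * hxy'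
  · fun_prop
  · have : HasDerivAt (fun t : ℝ ↦ t • intVec a + w) ((1 : ℝ) • intVec a) t :=
      ((hasDerivAt_id t).smul_const _).add_const _
    rw [this.deriv, one_smul]
    intro h0
    have h1 : (a.1 : ℝ) = 0 := congrArg Prod.fst h0
    have h2 : (a.2 : ℝ) = 0 := congrArg Prod.snd h0
    simp [h1, h2] at hxy'

/-- A small circle gives a null-homotopic simple closed curve. -/
lemma exists_circle (w : ℝ × ℝ) {r : ℝ} (hr : 0 < r) (hr' : r < 1 / 2) :
    ∃ u : C(UnitAddCircle, Torus),
      IsLift (fun t ↦ w + (r * Real.cos (2 * Real.pi * t), r * Real.sin (2 * Real.pi * t))) u 0 ∧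
      IsSimpleClosedCurve u := by
  have hz : intVec 0 = 0 := by ext <;> simp [intVec]
  obtain ⟨u, hu⟩ := exists_curve (a := 0)
    (g := fun t ↦ w + (r * Real.cos (2 * Real.pi * t), r * Real.sin (2 * Real.pi * t)))
    (by fun_prop) (fun t ↦ by simp only [hz, add_zero, mul_add, mul_one, Real.cos_add_two_pi,
      Real.sin_add_two_pi])
  -- The diameter `2r` is less than 1, so no nonzero lattice translation can match two points of the
  -- circle.
  have key : ∀ x y : ℝ, |x| ≤ 1 → |y| ≤ 1 → ∀ n : ℤ, r * x = r * y + n → x = y := by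
    intro x y hx hy n h
    rw [abs_le] at hx hy
    have h1 : (n : ℝ) < 1 := by nlinarith
    have h2 : (-1 : ℝ) < n := by nlinarith
    have h3 : n = 0 := by
      have h1 : n < 1 := mod_cast h1
      have h2 : -1 < n := mod_cast h2
      omega
    subst h3
    simpa [hr.ne'] using h
  refine ⟨u, hu, hu.injective ?_, _, ?_, hu.proj_eq, fun t ↦ ?_⟩
  · intro s t m h
    have h1 := congrArg Prod.fst h
    have h2 := congrArg Prod.snd h
    simp only [intVec, Prod.fst_add, Prod.snd_add, add_assoc, add_right_inj] at h1 h2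
    have h3 := key _ _ (Real.abs_cos_le_one _) (Real.abs_cos_le_one _) _ h1
    have h4 := key _ _ (Real.abs_sin_le_one _) (Real.abs_sin_le_one _) _ h2
    have h5 := Real.Angle.cos_sin_inj h3 h4
    rw [Real.Angle.angle_eq_iff_two_pi_dvd_sub] at h5
    obtain ⟨k, hk⟩ := h5
    refine ⟨k, ?_⟩
    have := Real.pi_pos
    apply mul_left_cancel₀ (mul_pos two_pos this).ne'
    linear_combination hk
  · fun_prop
  · have hd : HasDerivAt (fun t : ℝ ↦ 2 * Real.pi * t) (2 * Real.pi) t := by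
      simpa using (hasDerivAt_id t).const_mul (2 * Real.pi)
    have := ((hd.cos.const_mul r).prodMk (hd.sin.const_mul r)).const_add w
    rw [this.deriv]
    intro h0
    have h1 := congrArg Prod.fst h0
    have h2 := congrArg Prod.snd h0
    have hpi := Real.pi_pos.ne'
    simp [hr.ne', hpi] at h1 h2
    have := Real.sin_sq_add_cos_sq (2 * Real.pi * t)
    simp [h1, h2] at this

/-! ### Bounding the intersection number by model curves -/

lemma intersectionNumber_comm (u v : C(UnitAddCircle, Torus)) :
    intersectionNumber u v = intersectionNumber v u := by
  have key : ∀ u v, intersectionNumber u v ≤ intersectionNumber v u := fun u v ↦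
    le_iInf fun v' ↦ le_iInf fun u' ↦ le_iInf fun hv' ↦ le_iInf fun hu' ↦
      iInf_le_of_le u' <| iInf_le_of_le v' <| iInf_le_of_le hu' <| iInf_le_of_le hv' <| by
        rw [Set.inter_comm]
  exact le_antisymm (key u v) (key v u)

lemma IsLift.intersectionNumber_le {g h g' h' : ℝ → ℝ × ℝ} {u v u' v' : C(UnitAddCircle, Torus)}
    {a b : ℤ × ℤ} (hu : IsLift g u a) (hv : IsLift h v b)
    (hu' : IsLift g' u' a ∧ IsSimpleClosedCurve u')
    (hv' : IsLift h' v' b ∧ IsSimpleClosedCurve v') :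
    intersectionNumber u v ≤ (Set.range u' ∩ Set.range v').encard :=
  iInf_le_of_le u' <| iInf_le_of_le v' <| iInf_le_of_le ⟨hu'.2, hu.homotopic hu'.1⟩ <|
    iInf_le_of_le ⟨hv'.2, hv.homotopic hv'.1⟩ le_rfl

lemma IsLift.range_eq {g : ℝ → ℝ × ℝ} {u : UnitAddCircle → Torus} {a : ℤ × ℤ}
    (hu : IsLift g u a) : Set.range u = Set.range (proj ∘ g) := by
  ext x
  constructor
  · rintro ⟨y, rfl⟩
    induction y using QuotientAddGroup.induction_on with
    | H t => exact ⟨t, hu.proj_eq t⟩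
  · rintro ⟨t, rfl⟩
    exact ⟨t, (hu.proj_eq t).symm⟩

lemma IsLift.intersectionNumber_eq_zero {g h g' h' : ℝ → ℝ × ℝ}
    {u v u' v' : C(UnitAddCircle, Torus)} {a b : ℤ × ℤ} (hu : IsLift g u a) (hv : IsLift h v b)
    (hu' : IsLift g' u' a ∧ IsSimpleClosedCurve u')
    (hv' : IsLift h' v' b ∧ IsSimpleClosedCurve v')
    (hd : ∀ s t m, h' s ≠ g' t + intVec m) : intersectionNumber u v = 0 := by
  have := hu.intersectionNumber_le hv hu' hv'
  rw [hu'.1.range_eq, hv'.1.range_eq, Set.encard_eq_zero.2, nonpos_iff_eq_zero] at this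
  · exact this
  · rw [← Set.disjoint_iff_inter_eq_empty, Set.disjoint_left]
    rintro _ ⟨t, rfl⟩ ⟨s, hs⟩
    obtain ⟨m, hm⟩ := proj_eq_iff.1 hs
    exact hd s t m hm

/-- The determinant of two lattice vectors. -/
def intCross (a b : ℤ × ℤ) : ℤ := a.1 * b.2 - a.2 * b.1

/-- A vector whose determinant with `b` is one half. -/
lemma exists_half (b : ℤ × ℤ) (hb : b ≠ 0) :
    ∃ w : ℝ × ℝ, (b.1 : ℝ) * w.2 - b.2 * w.1 = 1 / 2 := by
  have h : (b.1 : ℝ) ^ 2 + (b.2 : ℝ) ^ 2 ≠ 0 := by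
    intro h
    apply hb
    have h1 : (b.1 : ℝ) = 0 := by nlinarith [sq_nonneg (b.1 : ℝ), sq_nonneg (b.2 : ℝ)]
    have h2 : (b.2 : ℝ) = 0 := by nlinarith [sq_nonneg (b.1 : ℝ), sq_nonneg (b.2 : ℝ)]
    exact Prod.ext (mod_cast h1) (mod_cast h2)
  -- The vector `b` turned by a right angle and divided by `2|b|²`.
  refine ⟨(-(b.2 : ℝ) / (2 * (b.1 ^ 2 + b.2 ^ 2)), (b.1 : ℝ) / (2 * (b.1 ^ 2 + b.2 ^ 2))), ?_⟩
  field_simp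
  ring

/-- Disjointness criterion for the displacements below: the determinant with a fixed direction
separates the two curves by one half up to an error `x`, while lattice translations change it by
integers. -/
lemma half_add_ne_intCast {x : ℝ} (hx : |x| < 1 / 2) (n : ℤ) : 1 / 2 + x ≠ n := by
  intro h
  rw [abs_lt] at hx
  have h1 : (0 : ℝ) < n := by linarith
  have h2 : (n : ℝ) < 1 := by linarith
  have h1 : 0 < n := mod_cast h1
  have h2 : n < 1 := mod_cast h2
  omega

/-- A radius such that circles of this radius stay close to their centre in the direction
transverse to `b`. -/
lemma exists_radius (b : ℤ × ℤ) : ∃ r : ℝ, 0 < r ∧ r < 1 / 2 ∧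
    ∀ c s : ℝ, |c| ≤ 1 → |s| ≤ 1 → |(b.1 : ℝ) * (r * s) - b.2 * (r * c)| < 1 / 4 := by
  have h1 := abs_nonneg (b.1 : ℝ)
  have h2 := abs_nonneg (b.2 : ℝ)
  refine ⟨1 / (4 * (|(b.1 : ℝ)| + |(b.2 : ℝ)| + 1)), by positivity, ?_, fun c s hc hs ↦ ?_⟩
  · rw [div_lt_div_iff₀ (by positivity) (by positivity)]
    linarith
  · set D := |(b.1 : ℝ)| + |(b.2 : ℝ)| + 1 with hD
    have hD0 : 0 < D := by positivity
    have e : (b.1 : ℝ) * (1 / (4 * D) * s) - b.2 * (1 / (4 * D) * c)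
        = (b.1 * s - b.2 * c) / (4 * D) := by ring
    rw [e, abs_div, abs_of_pos (show 0 < 4 * D by positivity), div_lt_div_iff₀ (by positivity)
      (by positivity)]
    have h3 : |(b.1 : ℝ) * s - b.2 * c| ≤ |(b.1 : ℝ)| + |(b.2 : ℝ)| := by
      refine (abs_sub _ _).trans ?_
      rw [abs_mul, abs_mul]
      exact add_le_add (mul_le_of_le_one_right h1 hs) (mul_le_of_le_one_right h2 hc)
    linarith

/-- A null-homotopic curve can be displaced from any curve. -/
lemma IsLift.intersectionNumber_eq_zero_of_null {g h : ℝ → ℝ × ℝ}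
    {u v : C(UnitAddCircle, Torus)} {b : ℤ × ℤ} (hu : IsLift g u 0) (hv : IsLift h v b)
    (hb : b = 0 ∨ IsCoprime b.1 b.2) : intersectionNumber u v = 0 := by
  rcases hb with rfl | hb
  -- For `(1, 0)` the determinant is the second coordinate. The centres differ there by one half,
  -- and each circle contributes an error below one quarter.
  · obtain ⟨r, hr, hr', hr''⟩ := exists_radius (1, 0)
    obtain ⟨u', hu'⟩ := exists_circle (0, 1 / 2) hr hr'
    obtain ⟨v', hv'⟩ := exists_circle 0 hr hr'
    refine hv.intersectionNumber_eq_zero hu hv' hu' (fun s t m hm ↦ ?_) ▸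
      intersectionNumber_comm u v
    have h1 := abs_lt.1 (hr'' _ _ (Real.abs_cos_le_one (2 * Real.pi * s))
      (Real.abs_sin_le_one (2 * Real.pi * s)))
    have h2 := abs_lt.1 (hr'' _ _ (Real.abs_cos_le_one (2 * Real.pi * t))
      (Real.abs_sin_le_one (2 * Real.pi * t)))
    have h3 := congrArg Prod.snd hm
    simp only [intVec, Prod.snd_add, Prod.snd_zero] at h3
    push_cast at h1 h2
    refine half_add_ne_intCast (x := r * Real.sin (2 * Real.pi * s) - r * Real.sin (2 * Real.pi * t))
      (abs_lt.2 ⟨by linarith, by linarith⟩) m.2 (by linarith)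
  · have hb0 : b ≠ 0 := by rintro rfl; exact not_isCoprime_zero_zero hb
    -- The function `det(b, ·)` vanishes on the line through 0 and stays within one quarter of one
    -- half on the circle around `w`.
    obtain ⟨w, hw⟩ := exists_half b hb0
    obtain ⟨r, hr, hr', hr''⟩ := exists_radius b
    obtain ⟨u', hu'⟩ := exists_circle w hr hr'
    obtain ⟨v', hv'⟩ := exists_line b hb 0
    refine hv.intersectionNumber_eq_zero hu hv' hu' (fun s t m hm ↦ ?_) ▸
      intersectionNumber_comm u v
    have h1 := abs_lt.1 (hr'' _ _ (Real.abs_cos_le_one (2 * Real.pi * s))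
      (Real.abs_sin_le_one (2 * Real.pi * s)))
    have h3 := congrArg Prod.fst hm
    have h4 := congrArg Prod.snd hm
    simp only [intVec, Prod.snd_add, Prod.fst_add, Prod.smul_fst, Prod.smul_snd, smul_eq_mul,
      add_zero] at h3 h4
    refine half_add_ne_intCast (x := b.1 * (r * Real.sin (2 * Real.pi * s))
      - b.2 * (r * Real.cos (2 * Real.pi * s)))
      (abs_lt.2 ⟨by linarith, by linarith⟩) (intCross b m) ?_
    simp only [intCross]
    push_cast
    linear_combination b.1 * h4 - b.2 * h3 - hw

/-- Curves with parallel primitive classes can be made disjoint. -/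
lemma IsLift.intersectionNumber_eq_zero_of_intCross {g h : ℝ → ℝ × ℝ}
    {u v : C(UnitAddCircle, Torus)} {a b : ℤ × ℤ} (hu : IsLift g u a) (hv : IsLift h v b)
    (ha : IsCoprime a.1 a.2) (hb : IsCoprime b.1 b.2) (hab : intCross a b = 0) :
    intersectionNumber u v = 0 := by
  have ha0 : a ≠ 0 := by rintro rfl; exact not_isCoprime_zero_zero ha
  -- Since the directions are parallel, `det(a, ·)` is constantly 0 on the first line and one half
  -- on the second.
  obtain ⟨w, hw⟩ := exists_half a ha0
  obtain ⟨u', hu'⟩ := exists_line a ha 0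
  obtain ⟨v', hv'⟩ := exists_line b hb w
  refine hu.intersectionNumber_eq_zero hv hu' hv' (fun s t m hm ↦ ?_)
  have h3 := congrArg Prod.fst hm
  have h4 := congrArg Prod.snd hm
  simp only [intVec, Prod.snd_add, Prod.fst_add, Prod.smul_fst, Prod.smul_snd, smul_eq_mul,
    Prod.fst_zero, Prod.snd_zero] at h3 h4
  have hab' : (a.1 : ℝ) * b.2 - a.2 * b.1 = 0 := mod_cast hab
  refine half_add_ne_intCast (x := 0) (by norm_num) (intCross a m) ?_
  simp only [intCross]
  push_cast
  linear_combination a.1 * h4 - a.2 * h3 - hw - s * hab'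

/-- Geodesics of primitive classes `a` and `b` meet in at most `|det (a, b)|` points. -/
lemma IsLift.intersectionNumber_le_intCross {g h : ℝ → ℝ × ℝ}
    {u v : C(UnitAddCircle, Torus)} {a b : ℤ × ℤ} (hu : IsLift g u a) (hv : IsLift h v b)
    (ha : IsCoprime a.1 a.2) (hb : IsCoprime b.1 b.2) (hab : intCross a b ≠ 0) :
    intersectionNumber u v ≤ (intCross a b).natAbs := by
  obtain ⟨u', hu'⟩ := exists_line a ha 0
  obtain ⟨v', hv'⟩ := exists_line b hb 0
  refine (hu.intersectionNumber_le hv hu' hv').trans ?_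
  set n := intCross a b with hn
  have hnR : (n : ℝ) = a.1 * b.2 - a.2 * b.1 := by simp [hn, intCross]
  have hn0 : (n : ℝ) ≠ 0 := mod_cast hab
  -- Applying `det(b, ·)` to `s b = t a + m` gives `t = k / n` with `k = det(b, m)`. Reducing `k`
  -- modulo `n` shifts `t` by an integer, which leaves the point on the torus unchanged.
  have hsub : Set.range u' ∩ Set.range v' ⊆
      (fun j : ℤ ↦ proj (((j : ℝ) / n) • intVec a)) '' (Set.Ico 0 |n|) := by
    rw [hu'.1.range_eq, hv'.1.range_eq]
    rintro _ ⟨⟨t, rfl⟩, s, hs⟩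
    obtain ⟨m, hm⟩ := proj_eq_iff.1 hs
    have h3 := congrArg Prod.fst hm
    have h4 := congrArg Prod.snd hm
    simp only [intVec, Prod.snd_add, Prod.fst_add, Prod.smul_fst, Prod.smul_snd, smul_eq_mul,
      add_zero] at h3 h4
    set k := intCross b m with hk
    have hkR : (k : ℝ) = b.1 * m.2 - b.2 * m.1 := by simp [hk, intCross]
    refine ⟨k % n, ⟨Int.emod_nonneg _ hab, Int.emod_lt_abs _ hab⟩, ?_⟩
    have hdiv : ((k % n : ℤ) : ℝ) = k - n * (k / n : ℤ) := by
      have := Int.emod_add_mul_ediv k n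
      have : ((k % n + n * (k / n) : ℤ) : ℝ) = k := by rw [this]
      push_cast at this
      linarith
    have ht : t = k / n := by
      rw [eq_div_iff hn0, hnR, hkR]
      linear_combination b.1 * h4 - b.2 * h3
    simp only [Function.comp_apply, add_zero]
    refine proj_eq_iff.2 ⟨(-(k / n) * a.1, -(k / n) * a.2), ?_⟩
    rw [hdiv, ht]
    ext <;> simp [intVec] <;> field_simp <;> ring
  refine (Set.encard_le_encard hsub).trans ((Set.encard_image_le _ _).trans ?_)
  rw [← Finset.coe_Ico, Set.encard_coe_eq_coe_finsetCard, Int.card_Ico]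
  simp

/-! ### Simple closed curves have zero or primitive class -/

lemma exists_mem_Icc_forall_le_of_periodic {y : ℝ → ℝ} (hy : Continuous y)
    (hp : Function.Periodic y 1) : ∃ t ∈ Set.Icc (0 : ℝ) 1, ∀ s, y s ≤ y t := by
  obtain ⟨t, ht, h⟩ := isCompact_Icc.exists_isMaxOn (s := Set.Icc (0 : ℝ) 1)
    ⟨0, by simp⟩ hy.continuousOn
  refine ⟨t, ht, fun s ↦ ?_⟩
  obtain ⟨s', hs', e⟩ := hp.exists_mem_Ico₀ one_pos s
  rw [e]
  exact h (Set.Ico_subset_Icc_self hs')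

/-- An angle function cannot turn through the lower half plane along one edge of a rectangle and
through the upper half plane along the opposite one while staying in the right and left half planes
on the remaining two edges. -/
lemma angle_contradiction {θ : ℝ × ℝ → ℝ} (hθ : Continuous θ) {T : Set ℝ}
    (hT : IsPreconnected T) {N t₁ t₂ : ℝ} (h₁ : t₁ ∈ T) (h₂ : t₂ ∈ T)
    (hpos : ∀ t ∈ T, 0 < Real.cos (θ (N, t))) (hneg : ∀ t ∈ T, Real.cos (θ (-N, t)) < 0)
    (hlow : ∀ s, Real.sin (θ (s, t₁)) ≤ 0) (hup : ∀ s, 0 ≤ Real.sin (θ (s, t₂))) : False := by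
  have hivt : ∀ t a b z, z ∈ Set.Icc (θ (a, t)) (θ (b, t)) → ∃ s, θ (s, t) = z :=
    fun t a b z hz ↦ mem_range_of_exists_le_of_exists_ge
      (f := fun s ↦ θ (s, t)) (by fun_prop) ⟨a, hz.1⟩ ⟨b, hz.2⟩
  -- Otherwise every angle from `θ (N, t₁)` up to `θ (-N, t₁)` is attained on this edge, hence has
  -- nonpositive sine. Cosine would then increase from a positive to a negative value.
  have l1 : θ (-N, t₁) < θ (N, t₁) := by
    by_contra! hle
    have hm : MonotoneOn Real.cos (Set.Icc (θ (N, t₁)) (θ (-N, t₁))) := by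
      refine monotoneOn_of_deriv_nonneg (convex_Icc _ _) Real.continuous_cos.continuousOn
        Real.differentiable_cos.differentiableOn fun z hz ↦ ?_
      obtain ⟨s, rfl⟩ := hivt t₁ _ _ z (interior_subset hz)
      simpa using hlow s
    exact absurd (hm (Set.left_mem_Icc.2 hle) (Set.right_mem_Icc.2 hle) hle)
      (not_le.2 ((hneg t₁ h₁).trans (hpos t₁ h₁)))
  have l2 : θ (N, t₂) < θ (-N, t₂) := by
    by_contra! hle
    have hm : AntitoneOn Real.cos (Set.Icc (θ (-N, t₂)) (θ (N, t₂))) := by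
      refine antitoneOn_of_deriv_nonpos (convex_Icc _ _) Real.continuous_cos.continuousOn
        Real.differentiable_cos.differentiableOn fun z hz ↦ ?_
      obtain ⟨s, rfl⟩ := hivt t₂ _ _ z (interior_subset hz)
      simpa using hup s
    exact absurd (hm (Set.left_mem_Icc.2 hle) (Set.right_mem_Icc.2 hle) hle)
      (not_le.2 ((hneg t₂ h₂).trans (hpos t₂ h₂)))
  -- The angle difference between the two remaining edges changes sign, so it vanishes for some `t`,
  -- where the cosine would be both positive and negative.
  obtain ⟨t, ht, e⟩ := hT.intermediate_value₂ h₁ h₂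
    (f := fun t ↦ θ (-N, t)) (g := fun t ↦ θ (N, t)) (by fun_prop) (by fun_prop) l1.le l2.le
  have := hneg t ht
  rw [show θ (-N, t) = θ (N, t) from e] at this
  exact lt_asymm this (hpos t ht)

/-- Lattice vectors parallel to the class of a simple closed curve are multiples of the class. -/
lemma IsLift.exists_eq_smul {g : ℝ → ℝ × ℝ} {u : UnitAddCircle → Torus} {a b : ℤ × ℤ}
    (hu : IsLift g u a) (hinj : Function.Injective u) (ha : a ≠ 0)
    (hab : a.1 * b.2 - a.2 * b.1 = 0) : ∃ n : ℤ, intVec b = n • intVec a := by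
  by_contra! hb
  have hg := hu.continuous
  -- Coordinates along and across `a`, both scaled by `|a|`.
  let R : ℝ × ℝ → ℝ := fun p ↦ a.1 * p.1 + a.2 * p.2
  let J : ℝ × ℝ → ℝ := fun p ↦ a.1 * p.2 - a.2 * p.1
  have hR : Continuous R := by fun_prop
  have hJ : Continuous J := by fun_prop
  have hR_sub : ∀ p q, R (p - q) = R p - R q := fun p q ↦ by simp [R]; ring
  have hJ_sub : ∀ p q, J (p - q) = J p - J q := fun p q ↦ by simp [J]; ring
  have hJb : J (intVec b) = 0 := by simp only [J, intVec]; exact_mod_cast hab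
  set D : ℝ := a.1 ^ 2 + a.2 ^ 2 with hD
  have hDpos : 0 < D := by
    rcases eq_or_ne a.1 0 with h1 | h1
    · have h2 : a.2 ≠ 0 := fun h2 ↦ ha (Prod.ext h1 h2)
      positivity
    · positivity
  have hzero : ∀ p, R p = 0 → J p = 0 → p = 0 := by
    intro p h1 h2
    have e1 : D * p.1 = 0 := by simp only [R, J] at h1 h2; linear_combination a.1 * h1 - a.2 * h2
    have e2 : D * p.2 = 0 := by simp only [R, J] at h1 h2; linear_combination a.2 * h1 + a.1 * h2
    exact Prod.ext (by simpa [hDpos.ne'] using e1) (by simpa [hDpos.ne'] using e2)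
  -- A zero of `V` is a point where the lift meets its translate by `b`; injectivity of `u` would
  -- then make `b` a multiple of `a`.
  let V : ℝ × ℝ → ℝ × ℝ := fun x ↦ g x.1 - g x.2 - intVec b
  have hV : Continuous V := by fun_prop
  have hV0 : ∀ x, V x ≠ 0 := by
    rintro ⟨s, t⟩ h
    have h : g s = g t + intVec b := by
      rw [← sub_eq_iff_eq_add']; exact sub_eq_zero.1 h
    have h' : u s = u t := by
      rw [← hu.proj_eq, ← hu.proj_eq]; exact proj_eq_iff.2 ⟨b, h⟩
    obtain ⟨n, rfl⟩ := coe_eq_coe_iff.1 (hinj h')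
    rw [apply_add_intCast hu.add_one] at h
    exact hb n (add_left_cancel h).symm
  let F : ℝ × ℝ → ℂ := fun x ↦ ⟨R (V x), J (V x)⟩
  have hF : Continuous F := by
    have : F = fun x ↦ (R (V x) : ℂ) + (J (V x) : ℂ) * Complex.I := by
      ext x; exact Complex.mk_eq_add_mul_I _ _
    rw [this]
    fun_prop
  have hF0 : ∀ x, F x ≠ 0 := fun x h ↦
    hV0 x (hzero _ (congrArg Complex.re h) (congrArg Complex.im h))
  -- The plane is simply connected, so the nowhere zero `F` has a continuous logarithm, whose
  -- imaginary part is a global angle for `V`.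
  obtain ⟨L, hL, hLF⟩ := Complex.exists_continuousOn_eqOn_exp_comp (U := (Set.univ : Set (ℝ × ℝ)))
    (@SimplyConnectedSpace.ofContractible _ _
      (convex_univ.contractibleSpace Set.univ_nonempty)) isOpen_univ hF.continuousOn
    (by rintro ⟨x, -, hx⟩; exact hF0 x hx)
  rw [continuousOn_univ] at hL
  have hre : ∀ x, R (V x) = Real.exp (L x).re * Real.cos (L x).im := fun x ↦ by
    rw [← Complex.exp_re]; exact congrArg Complex.re (hLF (Set.mem_univ x)).symm
  have him : ∀ x, J (V x) = Real.exp (L x).re * Real.sin (L x).im := fun x ↦ by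
    rw [← Complex.exp_im]; exact congrArg Complex.im (hLF (Set.mem_univ x)).symm
  have hper : Function.Periodic (fun t ↦ J (g t)) 1 := fun t ↦ by
    simp only [J, hu.add_one, intVec, Prod.fst_add, Prod.snd_add]; ring
  have hgrow : ∀ t (n : ℤ), R (g (t + n)) = R (g t) + n * D := fun t n ↦ by
    rw [apply_add_intCast hu.add_one]
    simp only [R, hD, intVec, Prod.fst_add, Prod.snd_add, Prod.smul_mk, zsmul_eq_mul]
    ring
  -- As `J` kills `b`, fixing the second parameter where `J ∘ g` is maximal or minimal confines `V`
  -- to the closed lower or upper half plane.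
  obtain ⟨t₁, ht₁, hmax⟩ := exists_mem_Icc_forall_le_of_periodic (hJ.comp hg) hper
  obtain ⟨t₂, ht₂, hmin⟩ := exists_mem_Icc_forall_le_of_periodic (hJ.comp hg).neg
    (fun t ↦ congrArg Neg.neg (hper t))
  obtain ⟨B, hB⟩ := (isCompact_Icc (a := (0 : ℝ)) (b := 1)).exists_bound_of_continuousOn
    (f := fun t ↦ R (g t)) (by fun_prop)
  -- Each period adds `D` to `R ∘ g`, so after `N` periods forward or backward it dominates all
  -- bounded terms and fixes the sign of `R (V (±N, t))`.
  obtain ⟨N, hN⟩ := exists_nat_gt ((|R (g 0)| + B + |R (intVec b)|) / D)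
  rw [div_lt_iff₀ hDpos] at hN
  have hgN := hgrow 0 N
  have hgN' := hgrow 0 (-N)
  push_cast at hgN hgN'
  rw [zero_add] at hgN hgN'
  refine angle_contradiction (θ := fun x ↦ (L x).im) (by fun_prop)
    (isPreconnected_Icc (a := (0 : ℝ)) (b := 1)) (N := N) ht₁ ht₂ ?_ ?_ ?_ ?_
  · intro t ht
    refine pos_of_mul_pos_right ((hre (N, t)).symm ▸ ?_) (Real.exp_pos (L (N, t)).re).le
    have h1 := abs_le.1 (hB t ht)
    have h2 := neg_abs_le (R (g 0))
    have h3 := le_abs_self (R (intVec b))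
    simp only [V, hR_sub, hgN]
    linarith
  · intro t ht
    refine neg_of_mul_neg_right ((hre (-N, t)).symm ▸ ?_) (Real.exp_pos (L (-N, t)).re).le
    have h1 := abs_le.1 (hB t ht)
    have h2 := le_abs_self (R (g 0))
    have h3 := neg_abs_le (R (intVec b))
    simp only [V, hR_sub, hgN']
    linarith
  · intro s
    refine nonpos_of_mul_nonpos_right ((him (s, t₁)).symm ▸ ?_) (Real.exp_pos (L (s, t₁)).re)
    have : J (g s) ≤ J (g t₁) := hmax s
    simp only [V, hJ_sub, hJb]
    linarith
  · intro s
    refine nonneg_of_mul_nonneg_right ((him (s, t₂)).symm ▸ ?_) (Real.exp_pos (L (s, t₂)).re)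
    have : -J (g s) ≤ -J (g t₂) := hmin s
    simp only [V, hJ_sub, hJb]
    linarith

/-- The class of a simple closed curve is zero or primitive. -/
lemma IsLift.isCoprime {g : ℝ → ℝ × ℝ} {u : UnitAddCircle → Torus} {a : ℤ × ℤ}
    (hu : IsLift g u a) (hinj : Function.Injective u) : a = 0 ∨ IsCoprime a.1 a.2 := by
  refine or_iff_not_imp_left.2 fun ha ↦ ?_
  rw [Int.isCoprime_iff_gcd_eq_one]
  obtain ⟨x, hx⟩ := Int.gcd_dvd_left a.1 a.2
  obtain ⟨y, hy⟩ := Int.gcd_dvd_right a.1 a.2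
  set k := Int.gcd a.1 a.2
  -- The class divided by its gcd `k` is parallel to `a`, hence equals `n • a`; this forces `k * n =
  -- 1`.
  obtain ⟨n, hn⟩ := hu.exists_eq_smul (b := (x, y)) hinj ha
    (by simp only; rw [hx, hy]; ring)
  have h1 : (x : ℝ) = n * a.1 := by simpa [intVec] using congrArg Prod.fst hn
  have h2 : (y : ℝ) = n * a.2 := by simpa [intVec] using congrArg Prod.snd hn
  have h1 : x = n * a.1 := mod_cast h1
  have h2 : y = n * a.2 := mod_cast h2
  have h3 : (k * n - 1) * a.1 = 0 := by linear_combination - hx - k * h1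
  have h4 : (k * n - 1) * a.2 = 0 := by linear_combination - hy - k * h2
  have h5 : (k : ℤ) * n = 1 := by
    by_contra hne
    have hne : (k : ℤ) * n - 1 ≠ 0 := sub_ne_zero.2 hne
    exact ha (Prod.ext (by simpa [hne] using h3) (by simpa [hne] using h4))
  have := Int.eq_one_or_neg_one_of_mul_eq_one h5
  omega

/-! ### The Jacobian sign passes to the lattice action -/

lemma det_prod_eq (T : ℝ × ℝ →ₗ[ℝ] ℝ × ℝ) :
    LinearMap.det T = (T (1, 0)).1 * (T (0, 1)).2 - (T (0, 1)).1 * (T (1, 0)).2 := by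
  rw [← LinearMap.det_toMatrix (Module.Basis.finTwoProd ℝ), Matrix.det_fin_two]
  simp [LinearMap.toMatrix_apply]

/-- If the differential of a self-map of the plane that is equivariant with respect to a linear map
of the lattice has negative determinant everywhere, then so has the linear map. -/
lemma det_neg_of_det_fderiv_neg {C : ℝ × ℝ → ℝ × ℝ}
    (hC : ContDiff ℝ ((⊤ : ℕ∞) : WithTop ℕ∞) C) {p q r s : ℝ}
    (h1 : ∀ x, C (x + (1, 0)) = C x + (p, r)) (h2 : ∀ x, C (x + (0, 1)) = C x + (q, s))
    (hdet : ∀ x, LinearMap.det (fderiv ℝ C x : ℝ × ℝ →ₗ[ℝ] ℝ × ℝ) < 0) :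
    p * s - q * r < 0 := by
  let A : ℝ × ℝ → ℝ := fun x ↦ (C x).1
  let B : ℝ × ℝ → ℝ := fun x ↦ (C x).2
  have hA : ContDiff ℝ ((⊤ : ℕ∞) : WithTop ℕ∞) A := hC.fst
  have hB : ContDiff ℝ ((⊤ : ℕ∞) : WithTop ℕ∞) B := hC.snd
  have hAd : Differentiable ℝ A := hA.differentiable (by simp)
  have hBd : Differentiable ℝ B := hB.differentiable (by simp)
  have hCd : Differentiable ℝ C := hC.differentiable (by simp)
  let B1 : ℝ × ℝ → ℝ := fun x ↦ fderiv ℝ B x (1, 0)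
  let B2 : ℝ × ℝ → ℝ := fun x ↦ fderiv ℝ B x (0, 1)
  have hB' : ContDiff ℝ ((⊤ : ℕ∞) : WithTop ℕ∞) (fderiv ℝ B) :=
    hB.fderiv_right (by simp)
  have hA' : ContDiff ℝ ((⊤ : ℕ∞) : WithTop ℕ∞) (fderiv ℝ A) :=
    hA.fderiv_right (by simp)
  have hB'd : Differentiable ℝ (fderiv ℝ B) := hB'.differentiable (by simp)
  have hB1 : ∀ x, HasFDerivAt B1 ((fderiv ℝ (fderiv ℝ B) x).flip (1, 0)) x := fun x ↦ by
    simpa using (hB'd x).hasFDerivAt.clm_apply (hasFDerivAt_const (1, 0) x)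
  have hB2 : ∀ x, HasFDerivAt B2 ((fderiv ℝ (fderiv ℝ B) x).flip (0, 1)) x := fun x ↦ by
    simpa using (hB'd x).hasFDerivAt.clm_apply (hasFDerivAt_const (0, 1) x)
  -- The Jacobian is the divergence of `(A ∂₂B, -A ∂₁B)`, the mixed second derivatives of `B`
  -- cancelling. Its integral over the unit square is thus a boundary term.
  have hf : ∀ x, HasFDerivAt (fun x ↦ A x * B2 x) _ x := fun x ↦
    (hAd x).hasFDerivAt.mul (hB2 x)
  have hg : ∀ x, HasFDerivAt (fun x ↦ -(A x * B1 x)) _ x := fun x ↦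
    ((hAd x).hasFDerivAt.mul (hB1 x)).neg
  let d : ℝ × ℝ → ℝ := fun x ↦ LinearMap.det (fderiv ℝ C x : ℝ × ℝ →ₗ[ℝ] ℝ × ℝ)
  have hd : ∀ x, d x = fderiv ℝ A x (1, 0) * B2 x - fderiv ℝ A x (0, 1) * B1 x := fun x ↦ by
    have e1 : fderiv ℝ A x = (ContinuousLinearMap.fst ℝ ℝ ℝ).comp (fderiv ℝ C x) :=
      ((hCd x).hasFDerivAt.fst).fderiv
    have e2 : fderiv ℝ B x = (ContinuousLinearMap.snd ℝ ℝ ℝ).comp (fderiv ℝ C x) :=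
      ((hCd x).hasFDerivAt.snd).fderiv
    simp only [d, B1, B2, det_prod_eq, e1, e2]
    simp
  have hdc : Continuous d := by
    have c1 := hA'.continuous
    have c2 := hB'.continuous
    rw [funext hd]
    fun_prop
  have hint := MeasureTheory.integral2_divergence_prod_of_hasFDerivAt
    (fun x ↦ A x * B2 x) (fun x ↦ -(A x * B1 x)) _ _ 0 0 1 1
    (fun x _ ↦ (hf x).continuousAt.continuousWithinAt)
    (fun x _ ↦ (hg x).continuousAt.continuousWithinAt) (fun x _ ↦ hf x) (fun x _ ↦ hg x)
  have hsymm : ∀ x, fderiv ℝ (fderiv ℝ B) x (1, 0) (0, 1) = fderiv ℝ (fderiv ℝ B) x (0, 1) (1, 0) :=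
    fun x ↦ (hB.contDiffAt.isSymmSndFDerivAt (by simpa using WithTop.coe_le_coe.2 (le_top : (2 : ℕ∞) ≤ ⊤))) (1, 0) (0, 1)
  have hdiv : ∀ x, (A x • (fderiv ℝ (fderiv ℝ B) x).flip (0, 1) + B2 x • fderiv ℝ A x) (1, 0)
      + (-(A x • (fderiv ℝ (fderiv ℝ B) x).flip (1, 0) + B1 x • fderiv ℝ A x)) (0, 1) = d x := by
    intro x
    simp [hd, hsymm]
    ring
  simp only [hdiv] at hint
  replace hint := hint (hdc.continuousOn.integrableOn_compact (isCompact_uIcc.prod isCompact_uIcc))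
  have hneg : ∫ x in (0 : ℝ)..1, ∫ y in (0 : ℝ)..1, d (x, y) < 0 := by
    have i1 : ∀ x, 0 < ∫ y in (0 : ℝ)..1, -d (x, y) := fun x ↦
      intervalIntegral.intervalIntegral_pos_of_pos
        (Continuous.intervalIntegrable (by fun_prop) _ _) (fun y ↦ neg_pos.2 (hdet _)) one_pos
    have i2 := intervalIntegral.intervalIntegral_pos_of_pos (a := 0) (b := 1)
      (f := fun x ↦ ∫ y in (0 : ℝ)..1, -d (x, y))
      (Continuous.intervalIntegrable
        (intervalIntegral.continuous_parametric_intervalIntegral_of_continuous' (by fun_prop) _ _)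
        _ _) i1 one_pos
    simpa using i2
  have hB_add : ∀ x v w, (∀ x, C (x + v) = C x + w) → fderiv ℝ B (x + v) = fderiv ℝ B x := by
    intro x v w h
    rw [← fderiv_comp_add_right]
    have : (fun x ↦ B (x + v)) = fun x ↦ B x + w.2 := by
      ext x; simp [B, h]
    rw [this, fderiv_add_const]
  have t1 : ∫ y in (0 : ℝ)..1, B2 (0, y) = s := by
    rw [intervalIntegral.integral_eq_sub_of_hasDerivAt (f := fun y ↦ B (0, y))]
    · simpa [B, sub_eq_iff_eq_add'] using congrArg Prod.snd (h2 (0, 0))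
    · intro y _
      exact (hBd (0, y)).hasFDerivAt.comp_hasDerivAt y
        ((hasDerivAt_const y (0 : ℝ)).prodMk (hasDerivAt_id y))
    · refine Continuous.intervalIntegrable ?_ _ _
      have c2 := hB'.continuous
      fun_prop
  have t2 : ∫ x in (0 : ℝ)..1, B1 (x, 0) = r := by
    rw [intervalIntegral.integral_eq_sub_of_hasDerivAt (f := fun x ↦ B (x, 0))]
    · simpa [B, sub_eq_iff_eq_add'] using congrArg Prod.snd (h1 (0, 0))
    · intro y _
      exact (hBd (y, 0)).hasFDerivAt.comp_hasDerivAt (f := fun x : ℝ ↦ (x, (0 : ℝ))) y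
        ((hasDerivAt_id y).prodMk (hasDerivAt_const y (0 : ℝ)))
    · refine Continuous.intervalIntegrable ?_ _ _
      have c2 := hB'.continuous
      fun_prop
  -- The derivatives of `B` are periodic, so opposite edges differ only through the jumps `p` and
  -- `q` of `A`; the boundary term is `p * s - q * r`.
  have f1 : ∀ y, A (1, y) * B2 (1, y) = A (0, y) * B2 (0, y) + p * B2 (0, y) := fun y ↦ by
    have e : ((1 : ℝ), y) = (0, y) + (1, 0) := by simp
    simp only [B2, e, hB_add _ _ _ h1]
    simp only [A, h1, Prod.fst_add]
    ring
  have f2 : ∀ x, -(A (x, 1) * B1 (x, 1)) = -(A (x, 0) * B1 (x, 0)) - q * B1 (x, 0) := fun x ↦ by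
    have e : (x, (1 : ℝ)) = (x, 0) + (0, 1) := by simp
    simp only [B1, e, hB_add _ _ _ h2]
    simp only [A, h2, Prod.fst_add]
    ring
  have cA := hA.continuous
  have cB := hB'.continuous
  have ii : ∀ f : ℝ → ℝ, Continuous f → IntervalIntegrable f MeasureTheory.volume 0 1 :=
    fun f hf ↦ hf.intervalIntegrable _ _
  simp only [f1, f2] at hint
  rw [intervalIntegral.integral_add (ii _ (by fun_prop)) (ii _ (by fun_prop)),
    intervalIntegral.integral_sub (ii _ (by fun_prop)) (ii _ (by fun_prop)),
    intervalIntegral.integral_const_mul, intervalIntegral.integral_const_mul, t1, t2] at hint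
  linarith

/-! ### Action on the lattice and on invariant classes -/

/-- A lift of a self-map of the torus is equivariant with respect to an endomorphism of `ℤ²`. -/
lemma exists_lattice_hom {c : Torus → Torus} {C : ℝ × ℝ → ℝ × ℝ} (hC : Continuous C)
    (h : ∀ p, proj (C p) = c (proj p)) :
    ∃ M : ℤ × ℤ →+ ℤ × ℤ, ∀ p m, C (p + intVec m) = C p + intVec (M m) := by
  have : ∀ m, ∃ n, ∀ p, C (p + intVec m) = C p + intVec n := fun m ↦
    exists_eq_add_intVec (by fun_prop) hC
      (fun p ↦ by rw [h, h, proj_add, proj_intVec, add_zero])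
  choose M hM using this
  refine ⟨AddMonoidHom.mk' M fun m n ↦ intVec_injective ?_, fun p m ↦ hM m p⟩
  have h1 := hM (m + n) 0
  rw [intVec_add, ← add_assoc, hM n, hM m, add_assoc] at h1
  rw [intVec_add]
  exact (add_left_cancel h1).symm

/-- A self-map preserving a simple closed curve multiplies the class of this curve by an integer. -/
lemma IsLift.exists_map_eq_smul {c : Torus → Torus} {C : ℝ × ℝ → ℝ × ℝ} (hC : Continuous C)
    (h : ∀ p, proj (C p) = c (proj p)) {M : ℤ × ℤ → ℤ × ℤ}
    (hM : ∀ p m, C (p + intVec m) = C p + intVec (M m))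
    {g : ℝ → ℝ × ℝ} {u : C(UnitAddCircle, Torus)} {a : ℤ × ℤ} (hu : IsLift g u a)
    (hinj : Function.Injective u) (hinv : IsInvariant c u) : ∃ d : ℤ, M a = d • a := by
  have hemb := (u.continuous.isClosedEmbedding hinj).isEmbedding
  have : ∀ t : ℝ, ∃ x, u x = proj (C (g t)) := fun t ↦ by
    have : c (u t) ∈ Set.range u := hinv ▸ Set.mem_image_of_mem c ⟨(t : UnitAddCircle), rfl⟩
    rwa [h, hu.proj_eq]
  choose φ hφ using this
  have hg := hu.continuous
  -- The curve is an embedding, so the self-map of the circle induced by `c` is continuous and lifts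
  -- to some `f` on the line, with degree `d`.
  have hφc : Continuous φ := by
    rw [hemb.continuous_iff, show u ∘ φ = fun t ↦ proj (C (g t)) from funext hφ]
    fun_prop
  obtain ⟨e₀, he₀⟩ := QuotientAddGroup.mk_surjective (φ 0)
  obtain ⟨f, ⟨-, hf⟩, -⟩ := (AddCircle.isCoveringMap_coe (1 : ℝ)).existsUnique_continuousMap_lifts
    ⟨φ, hφc⟩ 0 e₀ he₀
  have hf : ∀ t, ((f t : ℝ) : UnitAddCircle) = φ t := congrFun hf
  have hφ1 : ∀ t, φ (t + 1) = φ t := fun t ↦ hinj <| by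
    rw [hφ, hφ, hu.add_one, h, h, proj_add, proj_intVec, add_zero]
  obtain ⟨d, hd⟩ : ∃ d : ℤ, f 1 = f 0 + d := coe_eq_coe_iff.1 (by
    rw [hf, hf, ← hφ1 0, zero_add])
  -- Both `C ∘ g` and `g ∘ f` lift the same path; comparing their increments over one period gives
  -- `M a = d • a`.
  obtain ⟨m, hm⟩ := exists_eq_add_intVec (f := fun t ↦ C (g t)) (g := fun t ↦ g (f t))
    (by fun_prop) (by fun_prop) (fun t ↦ by rw [hu.proj_eq, hf, hφ])
  refine ⟨d, intVec_injective ?_⟩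
  have h1 := hm 1
  have h0 := hm 0
  have h2 := hu.add_one 0
  simp only [zero_add] at h1 h0 h2
  rw [h2, hM, h0, hd, apply_add_intCast hu.add_one, add_right_comm, add_left_inj,
    add_right_inj] at h1
  rw [h1]
  simp [intVec]

/-! ### Integral involutions of negative determinant -/

lemma map_eq_or_eq_neg {M : ℤ × ℤ →+ ℤ × ℤ} (hM : ∀ m, M (M m) = m) {a : ℤ × ℤ} (ha : a ≠ 0)
    {d : ℤ} (hd : M a = d • a) : ∃ ε : ℤ, (ε = 1 ∨ ε = -1) ∧ M a = ε • a := by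
  refine ⟨d, ?_, hd⟩
  have h := hM a
  rw [hd, map_zsmul, hd, smul_smul] at h
  have h' : (d * d - 1) • a = 0 := by rw [sub_smul, h, one_smul, sub_self]
  rcases smul_eq_zero.1 h' with h' | h'
  · exact Int.eq_one_or_neg_one_of_mul_eq_one (sub_eq_zero.1 h')
  · exact absurd h' ha

/-- For a matrix of order two and determinant `-1`, primitive eigenvectors with opposite eigenvalues
have determinant dividing two. -/
lemma natAbs_intCross_le_two {p q r : ℤ} {a b : ℤ × ℤ}
    (ha : IsCoprime a.1 a.2) (hb : IsCoprime b.1 b.2)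
    (ha1 : p * a.1 + q * a.2 = a.1) (ha2 : r * a.1 - p * a.2 = a.2)
    (hb1 : p * b.1 + q * b.2 = -b.1) (hb2 : r * b.1 - p * b.2 = -b.2) :
    (intCross a b).natAbs ≤ 2 := by
  obtain ⟨x, y, hxy⟩ := ha
  obtain ⟨z, w, hzw⟩ := hb
  -- These four identities factor `M + 1` as the column `a` times an integral row, found by applying
  -- the Bézout row `(x, y)` of `a` to `M + 1`.
  have hγ1 : (x * (p + 1) + y * r) * a.1 = p + 1 := by
    linear_combination (p + 1) * hxy + y * ha2
  have hγ2 : (x * (p + 1) + y * r) * a.2 = r := by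
    linear_combination r * hxy - x * ha2
  have hα1 : (x * q + y * (1 - p)) * a.1 = q := by
    linear_combination q * hxy - y * ha1
  have hα2 : (x * q + y * (1 - p)) * a.2 = 1 - p := by
    linear_combination (1 - p) * hxy + x * ha1
  -- The row kills `b`, so it is a multiple of `(b.2, -b.1)`; the Bézout pair of `b` extracts the
  -- cofactor, and the trace of `M + 1` is 2.
  have hdvd : intCross a b ∣ 2 :=
    ⟨w * (x * (p + 1) + y * r) - z * (x * q + y * (1 - p)), by
      simp only [intCross]
      linear_combination -2 * hzw - w * b.2 * hγ1 + w * b.1 * hγ2 + z * b.2 * hα1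
        - z * b.1 * hα2 + w * hb2 + z * hb1⟩
  exact Int.natAbs_le_of_dvd_ne_zero hdvd two_ne_zero

lemma intCross_swap (a b : ℤ × ℤ) : (intCross a b).natAbs = (intCross b a).natAbs := by
  rw [← Int.natAbs_neg]
  congr 1
  simp only [intCross]
  ring

/-- Primitive vectors mapped to multiples of themselves by a linear involution of negative
determinant have determinant at most two. -/
lemma natAbs_intCross_le_two_of_map {M : ℤ × ℤ →+ ℤ × ℤ} (hM : ∀ m, M (M m) = m)
    (hdet : intCross (M (1, 0)) (M (0, 1)) < 0) {a b : ℤ × ℤ}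
    (ha : IsCoprime a.1 a.2) (hb : IsCoprime b.1 b.2)
    {d e : ℤ} (hMa : M a = d • a) (hMb : M b = e • b) : (intCross a b).natAbs ≤ 2 := by
  have ha0 : a ≠ 0 := by rintro rfl; exact not_isCoprime_zero_zero ha
  have hb0 : b ≠ 0 := by rintro rfl; exact not_isCoprime_zero_zero hb
  obtain ⟨ε, hε, hMa⟩ := map_eq_or_eq_neg hM ha0 hMa
  obtain ⟨δ, hδ, hMb⟩ := map_eq_or_eq_neg hM hb0 hMb
  obtain ⟨⟨p, r⟩, h1⟩ : ∃ x, M (1, 0) = x := ⟨_, rfl⟩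
  obtain ⟨⟨q, s⟩, h2⟩ : ∃ x, M (0, 1) = x := ⟨_, rfl⟩
  have hMx : ∀ m, M m = (p * m.1 + q * m.2, r * m.1 + s * m.2) := by
    intro m
    have : m = m.1 • (1, 0) + m.2 • (0, 1) := by ext <;> simp
    conv_lhs => rw [this]
    rw [map_add, map_zsmul, map_zsmul, h1, h2]
    ext <;> simp <;> ring
  have i1 := hM (1, 0)
  have i2 := hM (0, 1)
  simp only [h1, h2, intCross] at hdet
  simp only [h1, hMx, Prod.mk.injEq] at i1
  simp only [h2, hMx, Prod.mk.injEq] at i2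
  obtain ⟨i11, i12⟩ := i1
  obtain ⟨i21, i22⟩ := i2
  -- The entries of `M² = 1` show that a nonzero trace makes `M` scalar, and then its determinant
  -- would be a square.
  have htr : s = -p := by
    by_contra hne
    have hne : p + s ≠ 0 := fun h ↦ hne (by linarith)
    have hr : r = 0 := by
      have : (p + s) * r = 0 := by linarith
      simpa [hne] using this
    have hq : q = 0 := by
      have : (p + s) * q = 0 := by linarith
      simpa [hne] using this
    subst hr hq
    have : (p + s) * (p - s) = 0 := by linarith
    have hps : p = s := by
      rcases mul_eq_zero.1 this with h | h
      · exact absurd h hne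
      · linarith
    subst hps
    nlinarith [mul_self_nonneg p]
  subst htr
  rw [hMx] at hMa hMb
  have a1 : p * a.1 + q * a.2 = ε * a.1 := congrArg Prod.fst hMa
  have a2 : r * a.1 + -p * a.2 = ε * a.2 := congrArg Prod.snd hMa
  have b1 : p * b.1 + q * b.2 = δ * b.1 := congrArg Prod.fst hMb
  have b2 : r * b.1 + -p * b.2 = δ * b.2 := congrArg Prod.snd hMb
  by_cases heq : ε = δ
  · subst heq
    -- Independent eigenvectors with the same eigenvalue `ε` would make both diagonal entries `p`
    -- and `-p` equal to `ε`, although `ε` is nonzero.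
    suffices intCross a b = 0 by simp [this]
    by_contra hne
    have e1 : (p - ε) * intCross a b = 0 := by
      simp only [intCross]; linear_combination b.2 * a1 - a.2 * b1
    have e2 : (-p - ε) * intCross a b = 0 := by
      simp only [intCross]; linear_combination a.1 * b2 - b.1 * a2
    have e1 : p - ε = 0 := by simpa [hne] using e1
    have e2 : -p - ε = 0 := by simpa [hne] using e2
    omega
  · rcases hε with rfl | rfl <;> rcases hδ with rfl | rfl
    · exact absurd rfl heq
    · exact natAbs_intCross_le_two (p := p) (q := q) (r := r) ha hb
        (by linarith) (by linarith) (by linarith) (by linarith)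
    · rw [intCross_swap]
      exact natAbs_intCross_le_two (p := p) (q := q) (r := r) hb ha
        (by linarith) (by linarith) (by linarith) (by linarith)
    · exact absurd rfl heq

/-! ### Real structures and the final bound -/

/-- A real structure acts on `ℤ²` by an involution of negative determinant. -/
lemma IsRealStructure.exists_lift {c : Torus → Torus} (hc : IsRealStructure c) :
    ∃ (C : ℝ × ℝ → ℝ × ℝ) (M : ℤ × ℤ →+ ℤ × ℤ), Continuous C ∧ (∀ p, proj (C p) = c (proj p)) ∧
      (∀ p m, C (p + intVec m) = C p + intVec (M m)) ∧ (∀ m, M (M m) = m) ∧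
      intCross (M (1, 0)) (M (0, 1)) < 0 := by
  obtain ⟨C, hC, hlift, hdet⟩ := hc.smooth_orientation_reversing
  obtain ⟨M, hM⟩ := exists_lattice_hom hC.continuous hlift
  have hCc := hC.continuous
  refine ⟨C, M, hCc, hlift, hM, fun m ↦ intVec_injective ?_, ?_⟩
  -- Since `C ∘ C` lifts the identity, it is a lattice translation, and its lattice part `M²` is
  -- trivial.
  · obtain ⟨k, hk⟩ := exists_eq_add_intVec (f := fun p ↦ C (C p)) (g := id) (by fun_prop)
      continuous_id (fun p ↦ by rw [hlift, hlift, hc.involutive]; rfl)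
    have h1 := hk (0 + intVec m)
    have h0 := hk 0
    simp only [id] at h0 h1
    rw [hM, hM, h0, zero_add, zero_add, add_comm] at h1
    exact add_right_cancel h1
  · have e1 : intVec (1, 0) = (1, 0) := by simp [intVec]
    have e2 : intVec (0, 1) = (0, 1) := by simp [intVec]
    have := det_neg_of_det_fderiv_neg hC (fun x ↦ e1 ▸ hM x (1, 0)) (fun x ↦ e2 ▸ hM x (0, 1)) hdet
    have h : (M (1, 0)).1 * (M (0, 1)).2 - (M (0, 1)).1 * (M (1, 0)).2 < 0 := mod_cast this
    simp only [intCross]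
    linarith

/-- Invariant simple closed curves of a real structure have intersection number at most two. -/
lemma IsRealStructure.intersectionNumber_le_two {c : Torus → Torus} (hc : IsRealStructure c)
    {u v : C(UnitAddCircle, Torus)} (hu : IsSimpleClosedCurve u) (hv : IsSimpleClosedCurve v)
    (hcu : IsInvariant c u) (hcv : IsInvariant c v) : intersectionNumber u v ≤ 2 := by
  obtain ⟨C, M, hC, hlift, hM, hinv, hdet⟩ := hc.exists_lift
  obtain ⟨g, hg, hgu, -⟩ := hu.smooth_immersion
  obtain ⟨h, hh, hhv, -⟩ := hv.smooth_immersion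
  obtain ⟨a, ha⟩ := exists_isLift hg.continuous hgu
  obtain ⟨b, hb⟩ := exists_isLift hh.continuous hhv
  have hb' := hb.isCoprime hv.injective
  rcases ha.isCoprime hu.injective with rfl | ha'
  · simp [ha.intersectionNumber_eq_zero_of_null hb hb']
  rcases hb' with rfl | hb'
  · simp [intersectionNumber_comm u v, hb.intersectionNumber_eq_zero_of_null ha (.inr ha')]
  by_cases hab : intCross a b = 0
  · simp [ha.intersectionNumber_eq_zero_of_intCross hb ha' hb' hab]
  obtain ⟨d, hd⟩ := ha.exists_map_eq_smul hC hlift hM hu.injective hcu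
  obtain ⟨e, he⟩ := hb.exists_map_eq_smul hC hlift hM hv.injective hcv
  exact (ha.intersectionNumber_le_intCross hb ha' hb' hab).trans
    (mod_cast natAbs_intCross_le_two_of_map hinv hdet ha' hb' hd he)

end RealTorus

theorem mainTheorem6 (c : RealTorus.Torus → RealTorus.Torus)
    (hc : RealTorus.IsRealStructure c)
    (u v : C(UnitAddCircle, RealTorus.Torus))
    (hu : RealTorus.IsSimpleClosedCurve u) (hv : RealTorus.IsSimpleClosedCurve v)
    (hcu : RealTorus.IsInvariant c u) (hcv : RealTorus.IsInvariant c v) :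
    RealTorus.intersectionNumber u v = 0 ∨
      RealTorus.intersectionNumber u v = 1 ∨
      RealTorus.intersectionNumber u v = 2 := by
  have h := hc.intersectionNumber_le_two hu hv hcu hcv
  lift RealTorus.intersectionNumber u v to ℕ using (h.trans_lt (by decide)).ne with n
  have h : n ≤ 2 := mod_cast h
  interval_cases n <;> simp
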